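/- Let $n\ge 2$ be an even integer, let $g_0$ be the Euclidean metric on $\mathbb{R}^n$, and let $g=e^{2w}g_0$, where $w\in C^\infty(\mathbb{R}^n)$ is radial, i.e. $w(x)$ depends only on $r=\|x\|$. Let $\Delta=\sum_{i=1}^n\partial_i^2$ be the Euclidean Laplacian, let $$Q_g=e^{-nw}(-\Delta)^{n/2}w$$ be the $Q$-curvature of $g$, let $R_g$ be the scalar curvature of $g$ and $dv_g$ its Riemannian volume measure, and put $$C_n=\frac{1}{((n-2)!!)^2\,|S^{n-1}|},$$ where $|S^{n-1}|$ is the volume of the unit sphere in $\mathbb{R}^n$, $(2k)!!=(2k)(2k-2)\cdots 2$ and $0!!=1$. Suppose that 1. the metric $g$ is complete; 2. $R_g\ge 0$ outside some compact subset of $\mathbb{R}^n$; 3. $\int_{\mathbb{R}^n}|Q_g|\,dv_g<\infty$; 4. $\|x\|\,e^{w(x)}$ is bounded on $\mathbb{R}^n$. Then $$C_n\int_{\mathbb{R}^n}Q_g\,dv_g=1.$$ -/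

import Mathlib

open scoped ContDiff Manifold Bundle

namespace ConformalRn

/-- Euclidean space `ℝⁿ` (with the Euclidean norm). -/
abbrev E (n : ℕ) : Type := EuclideanSpace ℝ (Fin n)

section Space

variable {F : Type} [NormedAddCommGroup F] [InnerProductSpace ℝ F]

/-- Smooth Riemannian metrics on the manifold `F`, a Euclidean space. -/
abbrev Metric (F : Type) [NormedAddCommGroup F] [InnerProductSpace ℝ F] : Type :=
  Bundle.ContMDiffRiemannianMetric 𝓘(ℝ, F) ∞ F (fun x : F => TangentSpace 𝓘(ℝ, F) x)

/-- The conformally flat metric `g = e^{2w} g₀`, where `g₀` is the Euclidean metric. -/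
noncomputable def conformalMetric (w : F → ℝ) (hw : ContDiff ℝ ∞ w) : Metric F where
  inner x := (Real.exp (2 * w x) • innerSL ℝ (E := F) : F →L[ℝ] F →L[ℝ] ℝ)
  symm x u v := by
    change Real.exp (2 * w x) * inner ℝ (show F from u) (show F from v) =
      Real.exp (2 * w x) * inner ℝ (show F from v) (show F from u)
    rw [real_inner_comm]
  pos x v hv := by
    change 0 < Real.exp (2 * w x) * inner ℝ (show F from v) (show F from v)
    exact mul_pos (Real.exp_pos _) (real_inner_self_pos.2 hv)
  isVonNBounded x := by
    change Bornology.IsVonNBounded ℝ {v : F | Real.exp (2 * w x) * inner ℝ v v < 1}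
    refine (NormedSpace.isVonNBounded_ball ℝ F (Real.exp (-w x))).subset fun v hv => ?_
    have hv' : Real.exp (2 * w x) * inner ℝ v v < 1 := hv
    rw [mem_ball_zero_iff]
    rw [real_inner_self_eq_norm_sq, two_mul, Real.exp_add] at hv'
    rw [Real.exp_neg, ← one_div, lt_div_iff₀ (Real.exp_pos _)]
    have h0 : 0 ≤ ‖v‖ * Real.exp (w x) := by positivity
    nlinarith
  contMDiff := by
    have h : ContDiff ℝ ∞ (fun y : F => Real.exp (2 * w y)) := (contDiff_const.mul hw).exp
    exact h.contMDiff.smul_section ((riemannianMetricVectorSpace F).contMDiff.of_le le_top)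

/-- The metric space structure associated with `g`: the distance of two points is the infimum of
the `g`-lengths of the `C¹` paths joining them. -/
@[reducible] noncomputable def distanceSpace (g : Metric F) : PseudoEMetricSpace F :=
  letI : Bundle.RiemannianBundle (fun x : F => TangentSpace 𝓘(ℝ, F) x) :=
    ⟨g.toContinuousRiemannianMetric.toRiemannianMetric⟩
  PseudoEMetricSpace.ofRiemannianMetric 𝓘(ℝ, F) F

/-- The metric `g` is complete: the Riemannian distance of `g` makes the space a complete
metric space. -/
def IsCompleteMetric (g : Metric F) : Prop :=
  @CompleteSpace F (distanceSpace g).toUniformSpace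

end Space

section Curvature

variable {n : ℕ} (g : Metric (E n))

/-- The coefficients `g_{ij}` of the metric in the standard coordinates. -/
noncomputable def coeff (x : E n) : Matrix (Fin n) (Fin n) ℝ :=
  Matrix.of fun i j =>
    g.inner x (EuclideanSpace.single i (1 : ℝ) : E n) (EuclideanSpace.single j (1 : ℝ) : E n)

/-- The Riemannian volume measure `dv_g = √(det g_{ij}) dx`. -/
noncomputable def volumeMeasure : MeasureTheory.Measure (E n) :=
  MeasureTheory.volume.withDensity fun x => ENNReal.ofReal (Real.sqrt (coeff g x).det)

/-- The partial derivative `∂_i f`. -/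
noncomputable def partialDeriv (i : Fin n) (f : E n → ℝ) (x : E n) : ℝ :=
  fderiv ℝ f x (EuclideanSpace.single i (1 : ℝ))

/-- The Christoffel symbols
`Γ^k_{ij} = ½ ∑_l g^{kl} (∂_i g_{jl} + ∂_j g_{il} - ∂_l g_{ij})`. -/
noncomputable def christoffel (k i j : Fin n) (x : E n) : ℝ :=
  (1 / 2) * ∑ l, (coeff g x)⁻¹ k l *
    (partialDeriv i (fun y => coeff g y j l) x + partialDeriv j (fun y => coeff g y i l) x -
      partialDeriv l (fun y => coeff g y i j) x)

/-- The Ricci curvature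
`R_{ij} = ∑_k (∂_k Γ^k_{ij} - ∂_j Γ^k_{ik}) + ∑_{k,l} (Γ^k_{kl} Γ^l_{ij} - Γ^k_{jl} Γ^l_{ik})`. -/
noncomputable def ricci (i j : Fin n) (x : E n) : ℝ :=
  ∑ k, (partialDeriv k (christoffel g k i j) x - partialDeriv j (christoffel g k i k) x) +
    ∑ k, ∑ l, (christoffel g k k l x * christoffel g l i j x -
      christoffel g k j l x * christoffel g l i k x)

/-- The scalar curvature `R_g = ∑_{i,j} g^{ij} R_{ij}`. -/
noncomputable def scalarCurvature (x : E n) : ℝ :=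
  ∑ i, ∑ j, (coeff g x)⁻¹ i j * ricci g i j x

end Curvature

/-- The `Q`-curvature `Q_g = e^{-nw} (-Δ)^{n/2} w` of the conformally flat metric
`g = e^{2w} g₀` on `ℝⁿ`, for even `n`; here `Δ = ∑ ∂_i²` is the Euclidean Laplacian. -/
noncomputable def qCurvature {n : ℕ} (w : E n → ℝ) (x : E n) : ℝ :=
  Real.exp (-(n * w x)) * ((fun (u : E n → ℝ) (y : E n) => -Laplacian.laplacian u y)^[n / 2] w) x

/-- The volume `|S^{n-1}|` of the unit sphere of `ℝⁿ`, for its standard surface measure. -/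
noncomputable def sphereVolume (n : ℕ) : ℝ :=
  ((MeasureTheory.volume : MeasureTheory.Measure (E n)).toSphere).real Set.univ

/-- The constant `C_n = 1 / (((n-2)!!)² |S^{n-1}|)`; it is used for even `n ≥ 2` only. -/
noncomputable def gaussBonnetConstant (n : ℕ) : ℝ :=
  1 / ((Nat.doubleFactorial (n - 2) : ℝ) ^ 2 * sphereVolume n)

end ConformalRn

/-! ### Asymptotics of `f' - a f` -/

section FirstOrder

open Filter Topology

/-! In the variable `t = log ‖x‖`, with `f(t) = w` and `n = 2p + 2`, the operator `Δ^{p+1}` is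
`e^{-nt}` times a product of commuting factors `∂ - a` with constant `a`. One factor is a bare `∂`,
so `Δ^{p+1} w` is `e^{-nt} S'`, and the total curvature is `±|S^{n-1}| S(∞)`, since smoothness of
`w` at the origin gives `S(-∞) = 0` (`tendsto_total_qCurvature`).

`S` arises from `f'` by factors with `a ≠ 0`. A limit of `g' - a g` forces an extended limit of `g`
(`exists_tendsto_ereal_of_deriv_sub_mul`), so peeling the factors off shows that `f'` has an
extended limit (`firstOrder_radialIterate_limits`). The metric along a ray is `e^{f+t} dt`: a limit
above `-1` violates the bound on `‖x‖ e^w`, and one below `-1` makes rays finite in length, against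
completeness. So `f' → -1`, and each factor multiplies the limit by `-a`, which gives `S(∞)`. -/

theorem frequently_lt_deriv_sub_mul_of_crossing {f : ℝ → ℝ} (hf : Differentiable ℝ f) (a c : ℝ)
    (h₁ : ∃ᶠ t in atTop, f t < c) (h₂ : ∃ᶠ t in atTop, c < f t) :
    ∃ᶠ t in atTop, -(a * c) < deriv f t - a * f t := by
  rw [frequently_atTop] at *
  intro T
  obtain ⟨t₀, hT, h₀⟩ := h₁ T
  obtain ⟨t₁, h01, h₁⟩ := h₂ t₀
  have hlt : t₀ < t₁ := lt_of_le_of_ne h01 (by rintro rfl; linarith)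
  -- The integrating factor makes `f' - a f + a c` an exact derivative up to a positive factor; the
  -- function rises from a negative to a positive value on `[t₀, t₁]`.
  have hd : ∀ t, HasDerivAt (fun t => Real.exp (-a * t) * (f t - c))
      (Real.exp (-a * t) * (deriv f t - a * f t + a * c)) t := by
    intro t
    have h := (((hasDerivAt_id t).const_mul (-a)).exp).mul ((hf t).hasDerivAt.sub_const c)
    refine h.congr_deriv ?_
    simp only [id]
    ring
  obtain ⟨s, hs, hs'⟩ := exists_hasDerivAt_eq_slope _ _ hlt
    (fun t _ => (hd t).continuousAt.continuousWithinAt) (fun t _ => hd t)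
  refine ⟨s, hT.trans hs.1.le, ?_⟩
  have hpos : 0 < Real.exp (-a * s) * (deriv f s - a * f s + a * c) := by
    rw [hs']
    refine div_pos (sub_pos.2 ?_) (sub_pos.2 hlt)
    exact (mul_neg_of_pos_of_neg (Real.exp_pos _) (sub_neg.2 h₀)).trans
      (mul_pos (Real.exp_pos _) (sub_pos.2 h₁))
  linarith [pos_of_mul_pos_right hpos (Real.exp_pos _).le]

theorem frequently_deriv_sub_mul_lt_of_crossing {f : ℝ → ℝ} (hf : Differentiable ℝ f) (a c : ℝ)
    (h₁ : ∃ᶠ t in atTop, f t < c) (h₂ : ∃ᶠ t in atTop, c < f t) :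
    ∃ᶠ t in atTop, deriv f t - a * f t < -(a * c) := by
  have h := frequently_lt_deriv_sub_mul_of_crossing hf.neg a (-c)
    (h₂.mono fun t ht => by simpa using ht) (h₁.mono fun t ht => by simpa using ht)
  refine h.mono fun t ht => ?_
  rw [deriv.neg] at ht
  simp only [Pi.neg_apply] at ht
  linarith

/-- If `f' - a f` has a limit at infinity in the extended reals, then so does `f`. -/
theorem exists_tendsto_ereal_of_deriv_sub_mul {f : ℝ → ℝ} (hf : Differentiable ℝ f) {a : ℝ}
    (ha : a ≠ 0) {G : EReal}
    (hG : Tendsto (fun t => ((deriv f t - a * f t : ℝ) : EReal)) atTop (𝓝 G)) :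
    ∃ ℓ : EReal, Tendsto (fun t => (f t : EReal)) atTop (𝓝 ℓ) := by
  refine tendsto_of_no_upcrossings dense_univ fun x _ y _ hxy ⟨h₁, h₂⟩ => ?_
  -- Without a limit, `f` crosses every level in a gap infinitely often, and each level `c` forces
  -- `G = -ac`; two levels contradict `a ≠ 0`.
  have key : ∀ c : ℝ, x < c → (c : EReal) < y → G = ((-(a * c) : ℝ) : EReal) := by
    intro c hx hy
    have h₁' : ∃ᶠ t in atTop, f t < c := h₁.mono fun t ht => EReal.coe_lt_coe_iff.1 (ht.trans hx)
    have h₂' : ∃ᶠ t in atTop, c < f t := h₂.mono fun t ht => EReal.coe_lt_coe_iff.1 (hy.trans ht)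
    refine le_antisymm ?_ ?_
    · exact le_of_tendsto_of_frequently hG
        ((frequently_deriv_sub_mul_lt_of_crossing hf a c h₁' h₂').mono fun t ht =>
          EReal.coe_le_coe_iff.2 ht.le)
    · exact ge_of_tendsto_of_frequently hG
        ((frequently_lt_deriv_sub_mul_of_crossing hf a c h₁' h₂').mono fun t ht =>
          EReal.coe_le_coe_iff.2 ht.le)
  obtain ⟨c, hxc, hcy⟩ := EReal.exists_between_coe_real hxy
  obtain ⟨d, hcd, hdy⟩ := EReal.exists_between_coe_real hcy
  have h := (key c hxc hcy).symm.trans (key d (hxc.trans hcd) hdy)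
  rw [EReal.coe_eq_coe_iff, neg_inj] at h
  exact (EReal.coe_lt_coe_iff.1 hcd).ne (mul_left_cancel₀ ha h)

/-- The mean value theorem on `[t, t + 1]` yields points going to infinity along which `f'` tends to
`0`; the limit `G` can be read off there. -/
theorem ereal_limit_deriv_sub_mul {f : ℝ → ℝ} (hf : Differentiable ℝ f) {a ℓ : ℝ} {G : EReal}
    (hG : Tendsto (fun t => ((deriv f t - a * f t : ℝ) : EReal)) atTop (𝓝 G))
    (hℓ : Tendsto f atTop (𝓝 ℓ)) : G = ((-(a * ℓ) : ℝ) : EReal) := by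
  have hmv : ∀ t : ℝ, ∃ s, t < s ∧ deriv f s = f (t + 1) - f t := by
    intro t
    obtain ⟨s, hs, hs'⟩ := exists_deriv_eq_slope f (lt_add_one t) hf.continuous.continuousOn
      hf.differentiableOn
    exact ⟨s, hs.1, by simpa using hs'⟩
  choose s hs hs' using hmv
  have hst : Tendsto s atTop atTop := tendsto_atTop_mono (fun t => (hs t).le) tendsto_id
  have h1 : Tendsto (fun t => deriv f (s t) - a * f (s t)) atTop (𝓝 (ℓ - ℓ - a * ℓ)) := by
    simp only [hs']
    exact ((hℓ.comp (tendsto_atTop_add_const_right _ 1 tendsto_id)).sub hℓ).sub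
      ((hℓ.comp hst).const_mul a)
  rw [sub_self, zero_sub] at h1
  exact tendsto_nhds_unique (hG.comp hst)
    ((continuous_coe_real_ereal.tendsto _).comp h1)

end FirstOrder

namespace ConformalRn

/-! ### Incompleteness from decay along a ray -/

section Completeness

open Filter Topology MeasureTheory Set

variable {F : Type} [NormedAddCommGroup F] [InnerProductSpace ℝ F]

theorem edist_conformalMetric_le (w : F → ℝ) (hw : ContDiff ℝ ∞ w) {γ : ℝ → F}
    (hγ : ContDiff ℝ 1 γ) {a b : ℝ} (hab : a ≤ b) :
    (distanceSpace (conformalMetric w hw)).edist (γ a) (γ b) ≤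
      ∫⁻ t in Icc a b, ENNReal.ofReal (Real.exp (w (γ t)) * ‖deriv γ t‖) := by
  let _ : Bundle.RiemannianBundle (fun x : F => TangentSpace 𝓘(ℝ, F) x) :=
    ⟨(conformalMetric w hw).toContinuousRiemannianMetric.toRiemannianMetric⟩
  have h := Manifold.riemannianEDist_le_pathELength (I := 𝓘(ℝ, F)) (γ := γ) (a := a) (b := b)
    (x := γ a) (y := γ b) hγ.contMDiff.contMDiffOn rfl rfl hab
  rw [Manifold.pathELength_eq_lintegral_mfderiv_Icc] at h
  refine h.trans (le_of_eq ?_)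
  refine lintegral_congr fun t => ?_
  rw [← ofReal_norm]
  congr 1
  rw [mfderiv_eq_fderiv]
  change Real.sqrt (Real.exp (2 * w (γ t)) * inner ℝ (fderiv ℝ γ t 1) (fderiv ℝ γ t 1)) = _
  rw [fderiv_eq_smul_deriv, one_smul, real_inner_self_eq_norm_sq, Real.sqrt_mul (Real.exp_pos _).le,
    Real.sqrt_sq (norm_nonneg _), mul_comm 2, Real.exp_mul]
  congr 1
  rw [Real.rpow_two, Real.sqrt_sq (Real.exp_pos _).le]

/-- A metric `e^{2w} g₀` for which `‖x‖ e^{w(x)}` decays like a negative power of `‖x‖` along a ray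
is not complete. -/
theorem not_isCompleteMetric_of_decay (w : F → ℝ) (hw : ContDiff ℝ ∞ w) {e : F} (he : ‖e‖ = 1)
    {C ε : ℝ} (hε : 0 < ε)
    (h : ∀ᶠ t in atTop, w (Real.exp t • e) + t ≤ C - ε * t) :
    ¬ IsCompleteMetric (conformalMetric w hw) := by
  intro hc
  obtain ⟨N, hN⟩ := (h.exists_forall_of_atTop)
  obtain ⟨M, hM⟩ := exists_nat_ge N
  have hγ : ContDiff ℝ 1 (fun t : ℝ => Real.exp t • e) := Real.contDiff_exp.smul contDiff_const
  -- In the logarithmic parameter the ray has speed `e^{w+t}`, so consecutive distances are bounded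
  -- by a geometric sequence of ratio `e^{-ε}`.
  let x : ℕ → F := fun k => Real.exp ((M : ℝ) + k) • e
  have hr : ENNReal.ofReal (Real.exp (-ε)) < 1 := by
    rw [ENNReal.ofReal_lt_one, Real.exp_lt_one_iff]
    linarith
  have hstep : ∀ k, (distanceSpace (conformalMetric w hw)).edist (x k) (x (k + 1)) ≤
      ENNReal.ofReal (Real.exp (C - ε * M)) * ENNReal.ofReal (Real.exp (-ε)) ^ k := by
    intro k
    have hle := edist_conformalMetric_le w hw hγ (le_add_of_nonneg_right zero_le_one :
      (M : ℝ) + k ≤ M + k + 1)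
    have hx : x (k + 1) = Real.exp ((M : ℝ) + k + 1) • e := by
      simp only [x, Nat.cast_add, Nat.cast_one, add_assoc]
    rw [hx]
    refine hle.trans ?_
    calc _ ≤ ∫⁻ t in Icc ((M : ℝ) + k) (M + k + 1),
          ENNReal.ofReal (Real.exp (C - ε * (M + k))) := by
          refine setLIntegral_mono measurable_const fun t ht => ENNReal.ofReal_le_ofReal ?_
          have hd : deriv (fun t : ℝ => Real.exp t • e) t = Real.exp t • e :=
            ((Real.hasDerivAt_exp t).smul_const e).deriv
          rw [hd, norm_smul, he, mul_one, Real.norm_of_nonneg (Real.exp_pos _).le, ← Real.exp_add,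
            Real.exp_le_exp]
          have h1 := hN t (by linarith [ht.1, (Nat.cast_nonneg k : (0 : ℝ) ≤ k)])
          have h2 := mul_le_mul_of_nonneg_left ht.1 hε.le
          linarith
      _ = _ := by
          rw [setLIntegral_const, Real.volume_Icc, add_sub_cancel_left, ENNReal.ofReal_one, mul_one,
            ← ENNReal.ofReal_pow (Real.exp_pos _).le, ← ENNReal.ofReal_mul (Real.exp_pos _).le,
            ← Real.exp_nat_mul, ← Real.exp_add]
          congr 2
          ring
  have hcau := @cauchySeq_of_edist_le_geometric F (distanceSpace (conformalMetric w hw)) _ _ hr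
    ENNReal.ofReal_ne_top x hstep
  obtain ⟨y, hy⟩ := @cauchySeq_tendsto_of_complete F ℕ
    (distanceSpace (conformalMetric w hw)).toUniformSpace _ hc x hcau
  -- The Riemannian distance carries the norm topology, so this is a limit in norm, while `‖x k‖ →
  -- ∞`.
  have hy' : Tendsto x atTop (𝓝 y) := hy
  have hnorm : Tendsto (fun k => ‖x k‖) atTop atTop := by
    have : (fun k => ‖x k‖) = fun k : ℕ => Real.exp ((M : ℝ) + k) := by
      funext k
      simp only [x, norm_smul, he, mul_one, Real.norm_of_nonneg (Real.exp_pos _).le]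
    rw [this]
    exact Real.tendsto_exp_atTop.comp
      (tendsto_atTop_add_const_left _ _ tendsto_natCast_atTop_atTop)
  exact not_tendsto_nhds_of_tendsto_atTop hnorm _ hy'.norm

end Completeness

/-! ### The Laplacian in logarithmic radial coordinates -/

section Radial

open Filter Topology

variable {n : ℕ}

theorem hasFDerivAt_comp_log_norm {f : ℝ → ℝ} {f' : ℝ} {x : E n} (hx : x ≠ 0)
    (hf : HasDerivAt f f' (Real.log ‖x‖)) :
    HasFDerivAt (fun y : E n => f (Real.log ‖y‖)) ((f' * (‖x‖ ^ 2)⁻¹) • innerSL ℝ x) x := by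
  have hx' : ‖x‖ ^ 2 ≠ 0 := by simpa using hx
  have hlog : ∀ y : E n, Real.log ‖y‖ = (1 / 2) * Real.log (‖y‖ ^ 2) := by
    intro y
    rw [Real.log_pow]
    push_cast
    ring
  have h1 : HasFDerivAt (fun y : E n => Real.log ‖y‖) ((‖x‖ ^ 2)⁻¹ • innerSL ℝ x) x := by
    simp only [hlog]
    refine ((((hasStrictFDerivAt_norm_sq x).hasFDerivAt).log hx').const_mul (1 / 2)).congr_fderiv ?_
    ext v
    simp
    ring
  refine (hf.comp_hasFDerivAt x h1).congr_fderiv ?_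
  rw [smul_smul]

/-- The Laplacian of a radial function in logarithmic radial coordinates. -/
theorem laplacian_comp_log_norm {f : ℝ → ℝ} (hf : ContDiff ℝ ∞ f) {x : E n} (hx : x ≠ 0) :
    Laplacian.laplacian (fun y : E n => f (Real.log ‖y‖)) x =
      Real.exp (-2 * Real.log ‖x‖) *
        (deriv (deriv f) (Real.log ‖x‖) + (n - 2) * deriv f (Real.log ‖x‖)) := by
  have hf1 : ContDiff ℝ ∞ (deriv f) := by
    exact (contDiff_infty_iff_deriv.1 hf).2
  have hd := fun t => (hf.differentiable (by simp) t).hasDerivAt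
  have hd1 := fun t => (hf1.differentiable (by simp) t).hasDerivAt
  have hx2 : ‖x‖ ^ 2 ≠ 0 := by simpa using hx
  obtain ⟨B, hB⟩ : ∃ B : E n →L[ℝ] E n →L[ℝ] ℝ, ∀ u v, B u v = inner ℝ u v :=
    ⟨innerSL ℝ, fun _ _ => rfl⟩
  have hfd : fderiv ℝ (fun y : E n => f (Real.log ‖y‖)) =ᶠ[𝓝 x]
      fun y => (deriv f (Real.log ‖y‖) * (‖y‖ ^ 2)⁻¹) • B y := by
    filter_upwards [isOpen_ne.mem_nhds hx] with y hy
    rw [(hasFDerivAt_comp_log_norm hy (hd _)).fderiv]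
    ext v
    simp [hB]
  have hinv : HasFDerivAt (fun y : E n => (‖y‖ ^ 2)⁻¹)
      ((-2 * ((‖x‖ ^ 2)⁻¹ * (‖x‖ ^ 2)⁻¹)) • innerSL ℝ x) x := by
    refine ((hasDerivAt_inv hx2).comp_hasFDerivAt x
      (hasStrictFDerivAt_norm_sq x).hasFDerivAt).congr_fderiv ?_
    ext v
    simp
    ring
  have h2 := ((hasFDerivAt_comp_log_norm hx (hd1 (Real.log ‖x‖))).mul hinv).smul
    B.hasFDerivAt
  rw [InnerProductSpace.laplacian_eq_iteratedFDeriv_orthonormalBasis _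
    (EuclideanSpace.basisFun (Fin n) ℝ)]
  have hterm : ∀ i : Fin n, iteratedFDeriv ℝ 2 (fun y : E n => f (Real.log ‖y‖)) x
      ![EuclideanSpace.basisFun (Fin n) ℝ i, EuclideanSpace.basisFun (Fin n) ℝ i] =
      (deriv (deriv f) (Real.log ‖x‖) - 2 * deriv f (Real.log ‖x‖)) *
        ((‖x‖ ^ 2)⁻¹ * (‖x‖ ^ 2)⁻¹) * x i ^ 2 + deriv f (Real.log ‖x‖) * (‖x‖ ^ 2)⁻¹ := by
    intro i
    rw [iteratedFDeriv_two_apply, hfd.fderiv_eq]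
    erw [h2.fderiv]
    simp [EuclideanSpace.inner_single_right, hB]
    ring
  simp only [hterm]
  rw [Finset.sum_add_distrib, ← Finset.mul_sum, ← EuclideanSpace.real_norm_sq_eq, Finset.sum_const,
    Finset.card_univ, Fintype.card_fin, nsmul_eq_mul]
  have hexp : Real.exp (-2 * Real.log ‖x‖) = (‖x‖ ^ 2)⁻¹ := by
    rw [neg_mul, Real.exp_neg, mul_comm, Real.exp_mul, Real.exp_log (norm_pos_iff.2 hx),
      Real.rpow_two]
  rw [hexp]
  field_simp
  ring

end Radial

/-! ### Factorization of the iterated Laplacian -/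

section Factorization

open Filter Topology

/-- The first order operator `∂ - a`. -/
noncomputable def firstOrder (a : ℝ) (f : ℝ → ℝ) (t : ℝ) : ℝ :=
  deriv f t - a * f t

theorem contDiff_deriv {f : ℝ → ℝ} (hf : ContDiff ℝ ∞ f) : ContDiff ℝ ∞ (deriv f) :=
  (contDiff_infty_iff_deriv.1 hf).2

theorem ContDiff.firstOrder {f : ℝ → ℝ} (hf : ContDiff ℝ ∞ f) (a : ℝ) :
    ContDiff ℝ ∞ (firstOrder a f) :=
  (contDiff_deriv hf).sub (contDiff_const.mul hf)

/-- Peels off one factor: existence of the limit passes from `∂f - a f` back to `f`, its value from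
`f` forward. -/
theorem firstOrder_limits {f : ℝ → ℝ} (hf : Differentiable ℝ f) {a : ℝ} (ha : a ≠ 0)
    (h : ∃ G : EReal, Tendsto (fun t => (firstOrder a f t : EReal)) atTop (𝓝 G)) :
    (∃ G : EReal, Tendsto (fun t => (f t : EReal)) atTop (𝓝 G)) ∧
      ∀ ℓ : ℝ, Tendsto f atTop (𝓝 ℓ) → Tendsto (firstOrder a f) atTop (𝓝 (-(a * ℓ))) := by
  obtain ⟨G, hG⟩ := h
  refine ⟨exists_tendsto_ereal_of_deriv_sub_mul hf ha hG, fun ℓ hℓ => ?_⟩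
  rw [ereal_limit_deriv_sub_mul hf hG hℓ] at hG
  exact EReal.tendsto_coe.1 hG

/-- The functions `A_k` with `Δᵏ u = (e^{-2kt} A_k)(log ‖x‖)` for the radial function
`u = f (log ‖x‖)` on `ℝⁿ`. -/
noncomputable def radialIterate (n : ℕ) (f : ℝ → ℝ) : ℕ → ℝ → ℝ
  | 0 => f
  | k + 1 => firstOrder (2 * k + 2 - n) (firstOrder (2 * k) (radialIterate n f k))

theorem contDiff_radialIterate (n : ℕ) {f : ℝ → ℝ} (hf : ContDiff ℝ ∞ f) (k : ℕ) :
    ContDiff ℝ ∞ (radialIterate n f k) := by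
  induction k with
  | zero => exact hf
  | succ k ih => exact ContDiff.firstOrder (ContDiff.firstOrder ih _) _

theorem deriv_mul_exp_mul {f : ℝ → ℝ} (hf : Differentiable ℝ f) (c a : ℝ) :
    deriv (fun t => c * Real.exp (-a * t) * f t) =
      fun t => c * Real.exp (-a * t) * firstOrder a f t := by
  funext t
  have h := ((((hasDerivAt_id t).const_mul (-a)).exp).const_mul c).mul (hf t).hasDerivAt
  refine h.deriv.trans ?_
  simp only [firstOrder, id]
  ring

/-- The radial Laplacian is `e^{-2t} (∂ + n - 2) ∂`; moving `e^{-2kt}` to the left past it replaces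
`∂` by `∂ - 2k`. -/
theorem iterate_neg_laplacian_eq {n : ℕ} {u : E n → ℝ} {f : ℝ → ℝ} (hf : ContDiff ℝ ∞ f)
    (hu : ∀ x, x ≠ 0 → u x = f (Real.log ‖x‖)) (k : ℕ) :
    ∀ x, x ≠ 0 → ((fun (u : E n → ℝ) (y : E n) => -Laplacian.laplacian u y)^[k] u) x =
      (-1) ^ k * Real.exp (-(2 * k) * Real.log ‖x‖) * radialIterate n f k (Real.log ‖x‖) := by
  induction k with
  | zero => simpa [radialIterate] using hu
  | succ k ih =>
    intro x hx
    have hA := contDiff_radialIterate n hf k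
    have hS := ContDiff.firstOrder hA (2 * k)
    have hF : ContDiff ℝ ∞
        (fun t => (-1) ^ k * Real.exp (-(2 * k) * t) * radialIterate n f k t) := by
      fun_prop
    rw [Function.iterate_succ_apply']
    have hev : ((fun (u : E n → ℝ) (y : E n) => -Laplacian.laplacian u y)^[k] u) =ᶠ[𝓝 x]
        fun y => (fun t => (-1) ^ k * Real.exp (-(2 * k) * t) * radialIterate n f k t)
          (Real.log ‖y‖) := by
      filter_upwards [isOpen_ne.mem_nhds hx] with y hy
      exact ih y hy
    rw [(InnerProductSpace.laplacian_congr_nhds hev).eq_of_nhds, laplacian_comp_log_norm hF hx,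
      deriv_mul_exp_mul (hA.differentiable (by simp)),
      deriv_mul_exp_mul (hS.differentiable (by simp))]
    have hexp : Real.exp (-(2 * ((k + 1 : ℕ) : ℝ)) * Real.log ‖x‖) =
        Real.exp (-2 * Real.log ‖x‖) * Real.exp (-(2 * k) * Real.log ‖x‖) := by
      rw [← Real.exp_add]
      push_cast
      ring_nf
    rw [hexp]
    simp only [radialIterate]
    generalize firstOrder (2 * k) (radialIterate n f k) = S
    simp only [firstOrder]
    ring

/-- Functions `t ↦ eᵗ k(eᵗ)` with `k` smooth are stable under `∂ - a`. -/
theorem firstOrder_exp_mul {k : ℝ → ℝ} (hk : ContDiff ℝ ∞ k) (a : ℝ) :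
    ∃ k' : ℝ → ℝ, ContDiff ℝ ∞ k' ∧
      firstOrder a (fun t => Real.exp t * k (Real.exp t)) =
        fun t => Real.exp t * k' (Real.exp t) := by
  refine ⟨fun r => k r + r * deriv k r - a * k r, ?_, ?_⟩
  · have := contDiff_deriv hk
    fun_prop
  · funext t
    have h := (Real.hasDerivAt_exp t).mul
      (((hk.differentiable (by simp) (Real.exp t)).hasDerivAt).comp t (Real.hasDerivAt_exp t))
    have h' : deriv (fun t => Real.exp t * k (Real.exp t)) t = _ := h.deriv
    rw [firstOrder, h']
    simp only [Function.comp]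
    ring

/-- The first derivative of `h(eᵗ)` already carries a factor `eᵗ`, and the later operators preserve
it; this gives the decay at `-∞`, that is, at the origin. -/
theorem firstOrder_radialIterate_exp (n : ℕ) {h : ℝ → ℝ} (hh : ContDiff ℝ ∞ h) (k : ℕ) :
    ∃ k' : ℝ → ℝ, ContDiff ℝ ∞ k' ∧
      firstOrder (2 * k) (radialIterate n (fun t => h (Real.exp t)) k) =
        fun t => Real.exp t * k' (Real.exp t) := by
  induction k with
  | zero =>
    refine ⟨deriv h, contDiff_deriv hh, ?_⟩
    funext t
    have h' : deriv (fun t => h (Real.exp t)) t = _ :=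
      (((hh.differentiable (by simp) (Real.exp t)).hasDerivAt).comp t (Real.hasDerivAt_exp t)).deriv
    simp only [radialIterate, firstOrder, h']
    push_cast
    ring
  | succ k ih =>
    obtain ⟨k₁, hk₁, h₁⟩ := ih
    obtain ⟨k₂, hk₂, h₂⟩ := firstOrder_exp_mul hk₁ (2 * k + 2 - n)
    rw [radialIterate, h₁, h₂]
    exact firstOrder_exp_mul hk₂ _

theorem tendsto_firstOrder_radialIterate_atBot (n : ℕ) {h : ℝ → ℝ} (hh : ContDiff ℝ ∞ h) (k : ℕ) :
    Tendsto (firstOrder (2 * k) (radialIterate n (fun t => h (Real.exp t)) k)) atBot (𝓝 0) := by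
  obtain ⟨k', hk', h'⟩ := firstOrder_radialIterate_exp n hh k
  rw [h', ← zero_mul (k' 0)]
  exact Real.tendsto_exp_atBot.mul ((hk'.continuous.tendsto 0).comp Real.tendsto_exp_atBot)

/-- The factors `∂ - 2i` and `∂ + 2(p - i)` which lead from `f'` to the function whose derivative is
`Δ^{p+1}` in dimension `2p + 2`. -/
theorem firstOrder_radialIterate_limits (p : ℕ) {f : ℝ → ℝ} (hf : ContDiff ℝ ∞ f) (j : ℕ)
    (hj : j ≤ p)
    (h : ∃ G : EReal, Tendsto (fun t =>
      (firstOrder (2 * j) (radialIterate (2 * p + 2) f j) t : EReal)) atTop (𝓝 G)) :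
    (∃ G : EReal, Tendsto (fun t => ((deriv f t : ℝ) : EReal)) atTop (𝓝 G)) ∧
      ∀ ℓ : ℝ, Tendsto (deriv f) atTop (𝓝 ℓ) →
        Tendsto (firstOrder (2 * j) (radialIterate (2 * p + 2) f j)) atTop
          (𝓝 ((∏ i ∈ Finset.range j, (-(2 * (i + 1)) * (2 * (p - i)) : ℝ)) * ℓ)) := by
  induction j with
  | zero =>
    have h0 : firstOrder (2 * ((0 : ℕ) : ℝ)) (radialIterate (2 * p + 2) f 0) = deriv f := by
      funext t
      simp [firstOrder, radialIterate]
    rw [h0] at h ⊢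
    exact ⟨h, fun ℓ hℓ => by simpa using hℓ⟩
  | succ j ih =>
    have hA := contDiff_radialIterate (2 * p + 2) hf
    have h2 : (2 * ((j + 1 : ℕ) : ℝ)) ≠ 0 := by positivity
    have hjp : (j : ℝ) < p := by exact_mod_cast hj
    -- This constant is `-2(p - j)`; it would vanish only at `j = p`, which is the bare `∂` kept
    -- outside the product.
    have h3 : (2 * (j : ℝ) + 2 - ((2 * p + 2 : ℕ) : ℝ)) ≠ 0 := by
      push_cast
      intro h0
      linarith
    obtain ⟨ha, hb⟩ := firstOrder_limits ((hA (j + 1)).differentiable (by simp)) h2 h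
    obtain ⟨hc, hd⟩ := firstOrder_limits
      ((ContDiff.firstOrder (hA j) (2 * j)).differentiable (by simp)) h3 ha
    obtain ⟨he, hg⟩ := ih (by omega) hc
    refine ⟨he, fun ℓ hℓ => ?_⟩
    convert hb _ (hd _ (hg ℓ hℓ)) using 2
    rw [Finset.prod_range_succ]
    push_cast
    ring

/-- Each half of the product contributes `p!`, and `(-4)^p (p!)² = (-1)^p (2^p p!)²`. -/
theorem prod_factors_eq (p : ℕ) :
    ∏ i ∈ Finset.range p, (-(2 * (i + 1)) * (2 * (p - i)) : ℝ) =
      (-1) ^ p * (Nat.doubleFactorial (2 * p) : ℝ) ^ 2 := by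
  have h1 : ∏ i ∈ Finset.range p, ((i : ℝ) + 1) = p.factorial := by
    rw [← Finset.prod_range_add_one_eq_factorial]
    push_cast
    rfl
  have h2 : ∏ i ∈ Finset.range p, ((p : ℝ) - i) = p.factorial := by
    rw [← h1, ← Finset.prod_range_reflect]
    refine Finset.prod_congr rfl fun i hi => ?_
    have hi' := Finset.mem_range.1 hi
    rw [Nat.sub_sub, Nat.cast_sub (by omega)]
    push_cast
    ring
  have h3 : ∀ i : ℕ, (-(2 * (i + 1)) * (2 * (p - i)) : ℝ) = (-4) * ((i + 1) * (p - i)) := by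
    intro i
    ring
  simp only [h3]
  rw [Finset.prod_mul_distrib, Finset.prod_mul_distrib, h1, h2, Finset.prod_const,
    Finset.card_range, Nat.doubleFactorial_two_mul]
  push_cast
  rw [mul_pow, ← pow_mul, mul_comm p 2, pow_mul, neg_pow]
  norm_num
  ring

end Factorization

/-! ### The asymptotic slope of the conformal factor -/

section Slope

open Filter Topology

theorem exists_eventually_linear_le {f : ℝ → ℝ} (hf : Differentiable ℝ f) {c : ℝ}
    (h : ∀ᶠ t in atTop, c ≤ deriv f t) : ∃ C, ∀ᶠ t in atTop, C + c * t ≤ f t := by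
  obtain ⟨N, hN⟩ := h.exists_forall_of_atTop
  refine ⟨f N - c * N, ?_⟩
  filter_upwards [eventually_ge_atTop N] with t ht
  have := (convex_Ici N).mul_sub_le_image_sub_of_le_deriv hf.continuous.continuousOn
    hf.differentiableOn (fun x hx => hN x (interior_subset hx)) N (Set.mem_Ici.2 le_rfl) t ht ht
  linarith

/-- If `f'` has an extended limit, `f + t` is bounded above and does not tend to `-∞` linearly, then
`f'` tends to `-1`. -/
theorem tendsto_deriv_neg_one {f : ℝ → ℝ} (hf : Differentiable ℝ f)
    (hlim : ∃ G : EReal, Tendsto (fun t => ((deriv f t : ℝ) : EReal)) atTop (𝓝 G))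
    {B : ℝ} (hB : ∀ t, f t + t ≤ B)
    (hdecay : ∀ C ε : ℝ, 0 < ε → ¬ ∀ᶠ t in atTop, f t + t ≤ C - ε * t) :
    Tendsto (deriv f) atTop (𝓝 (-1)) := by
  obtain ⟨G, hG⟩ := hlim
  suffices h : G = ((-1 : ℝ) : EReal) by
    rw [h] at hG
    exact EReal.tendsto_coe.1 hG
  rcases lt_trichotomy G ((-1 : ℝ) : EReal) with h | h | h
  -- A slope eventually below some `r < -1` makes `f + t` decay linearly.
  · exfalso
    obtain ⟨r, hGr, hr⟩ := EReal.exists_between_coe_real h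
    have hr' : r < -1 := EReal.coe_lt_coe_iff.1 hr
    have hev : ∀ᶠ t in atTop, -r ≤ deriv (-f) t := by
      filter_upwards [hG.eventually_lt_const hGr] with t ht
      rw [deriv.neg]
      exact neg_le_neg (EReal.coe_lt_coe_iff.1 ht).le
    obtain ⟨C, hC⟩ := exists_eventually_linear_le hf.neg hev
    refine hdecay (-C) (-1 - r) (by linarith) ?_
    filter_upwards [hC] with t ht
    simp only [Pi.neg_apply] at ht
    linarith
  · exact h
  -- A slope eventually above some `r > -1` makes `f + t` unbounded above.
  · exfalso
    obtain ⟨r, hr, hGr⟩ := EReal.exists_between_coe_real h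
    have hr' : -1 < r := EReal.coe_lt_coe_iff.1 hr
    have hev : ∀ᶠ t in atTop, r ≤ deriv f t := by
      filter_upwards [hG.eventually_const_lt hGr] with t ht
      exact (EReal.coe_lt_coe_iff.1 ht).le
    obtain ⟨C, hC⟩ := exists_eventually_linear_le hf hev
    have htop : Tendsto (fun t : ℝ => C + (r + 1) * t) atTop atTop :=
      tendsto_atTop_add_const_left _ _ (tendsto_id.const_mul_atTop (by linarith))
    obtain ⟨t, ht, ht'⟩ := (hC.and (htop.eventually_gt_atTop B)).exists
    linarith [hB t]

end Slope

/-! ### Passing from `dv_g` to Lebesgue measure -/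

section Volume

open MeasureTheory

variable {n : ℕ}

theorem volumeMeasure_conformalMetric (w : E n → ℝ) (hw : ContDiff ℝ ∞ w) :
    volumeMeasure (conformalMetric w hw) =
      volume.withDensity fun x => ENNReal.ofReal (Real.exp (n * w x)) := by
  rw [volumeMeasure]
  congr 1
  funext x
  have hc : coeff (conformalMetric w hw) x =
      Real.exp (2 * w x) • (1 : Matrix (Fin n) (Fin n) ℝ) := by
    ext i j
    change Real.exp (2 * w x) * inner ℝ (EuclideanSpace.single i (1 : ℝ) : E n)
      (EuclideanSpace.single j (1 : ℝ) : E n) = _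
    rw [EuclideanSpace.inner_single_left]
    simp [Matrix.one_apply]
  rw [hc, Matrix.det_smul, Matrix.det_one, mul_one, Fintype.card_fin, ← Real.exp_nat_mul]
  congr 1
  rw [show (n : ℝ) * (2 * w x) = n * w x + n * w x by ring, Real.exp_add,
    Real.sqrt_mul_self (Real.exp_pos _).le]

theorem measurable_density {w : E n → ℝ} (hw : Continuous w) :
    Measurable fun x => Real.toNNReal (Real.exp (n * w x)) :=
  ((hw.const_mul _).rexp.measurable).real_toNNReal

theorem density_smul_qCurvature (w : E n → ℝ) (x : E n) :
    Real.toNNReal (Real.exp (n * w x)) • qCurvature w x =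
      ((fun (u : E n → ℝ) (y : E n) => -Laplacian.laplacian u y)^[n / 2] w) x := by
  rw [NNReal.smul_def, Real.coe_toNNReal _ (Real.exp_pos _).le, smul_eq_mul, qCurvature, ← mul_assoc,
    ← Real.exp_add, add_neg_cancel, Real.exp_zero, one_mul]

theorem integral_qCurvature (w : E n → ℝ) (hw : ContDiff ℝ ∞ w) :
    ∫ x, qCurvature w x ∂(volumeMeasure (conformalMetric w hw)) =
      ∫ x, ((fun (u : E n → ℝ) (y : E n) => -Laplacian.laplacian u y)^[n / 2] w) x := by
  rw [volumeMeasure_conformalMetric]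
  refine (integral_withDensity_eq_integral_smul (measurable_density hw.continuous) _).trans ?_
  simp only [density_smul_qCurvature]

theorem integrable_qCurvature_iff (w : E n → ℝ) (hw : ContDiff ℝ ∞ w) :
    Integrable (qCurvature w) (volumeMeasure (conformalMetric w hw)) ↔
      Integrable ((fun (u : E n → ℝ) (y : E n) => -Laplacian.laplacian u y)^[n / 2] w) := by
  rw [volumeMeasure_conformalMetric]
  refine (integrable_withDensity_iff_integrable_smul (measurable_density hw.continuous)).trans ?_
  simp only [density_smul_qCurvature]

end Volume

/-! ### Total curvature as a boundary term -/

section TotalCurvature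

open Filter Topology MeasureTheory Set

/-- If `r ↦ g(log r)'` is integrable on `(0, ∞)` and `g → 0` at `-∞`, then `g` has a limit at `∞`,
which is the integral. -/
theorem tendsto_integral_of_log {g : ℝ → ℝ} (hg : Differentiable ℝ g)
    (hbot : Tendsto g atBot (𝓝 0))
    (hint : IntegrableOn (fun r => deriv g (Real.log r) * r⁻¹) (Ioi 0)) :
    Tendsto g atTop (𝓝 (∫ r in Ioi (0 : ℝ), deriv g (Real.log r) * r⁻¹)) := by
  have hd : ∀ r ∈ Ioi (0 : ℝ), HasDerivAt (fun r => g (Real.log r))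
      (deriv g (Real.log r) * r⁻¹) r := fun r hr =>
    (hg _).hasDerivAt.comp r (Real.hasDerivAt_log (ne_of_gt hr))
  have hlim := tendsto_limUnder_of_hasDerivAt_of_integrableOn_Ioi hd hint
  have hzero : Tendsto (fun r => g (Real.log r)) (𝓝[>] 0) (𝓝 0) :=
    hbot.comp Real.tendsto_log_nhdsGT_zero
  have hval := integral_Ioi_of_hasDerivAt_of_tendsto
    -- Since `log 0 = 0` by convention, the value at `r = 0` is reset to the limit `0` to get
    -- continuity there.
    (f := Function.update (fun r => g (Real.log r)) 0 0)
    (f' := fun r => deriv g (Real.log r) * r⁻¹) (a := 0) (m := limUnder atTop fun r => g (Real.log r))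
    ?_ ?_ hint ?_
  · rw [Function.update_self, sub_zero] at hval
    rw [hval]
    have := hlim.comp Real.tendsto_exp_atTop
    simpa [Function.comp_def] using this
  · rw [← continuousWithinAt_Ioi_iff_Ici, ContinuousWithinAt, Function.update_self]
    refine hzero.congr' ?_
    filter_upwards [self_mem_nhdsWithin] with r hr
    rw [Function.update_of_ne (ne_of_gt hr)]
  · intro r hr
    refine (hd r hr).congr_of_eventuallyEq ?_
    filter_upwards [Ioi_mem_nhds hr] with s hs
    rw [Function.update_of_ne (ne_of_gt hs)]
  · refine hlim.congr' ?_
    filter_upwards [eventually_gt_atTop 0] with r hr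
    rw [Function.update_of_ne (ne_of_gt hr)]

/-- The total `Q`-curvature of a radial metric as a boundary term at infinity. -/
theorem tendsto_total_qCurvature (p : ℕ) {u : E (2 * p + 2) → ℝ} {h : ℝ → ℝ}
    (hh : ContDiff ℝ ∞ h) (hu : ∀ x, x ≠ 0 → u x = h (Real.exp (Real.log ‖x‖)))
    (hint : Integrable
      ((fun (u : E (2 * p + 2) → ℝ) (y : E (2 * p + 2)) => -Laplacian.laplacian u y)^[p + 1] u)) :
    ∃ L : ℝ,
      Tendsto (firstOrder (2 * p) (radialIterate (2 * p + 2) (fun t => h (Real.exp t)) p)) atTop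
        (𝓝 L) ∧
      ∫ x, ((fun (u : E (2 * p + 2) → ℝ) (y : E (2 * p + 2)) =>
        -Laplacian.laplacian u y)^[p + 1] u) x =
        sphereVolume (2 * p + 2) * ((-1) ^ (p + 1) * L) := by
  have hf : ContDiff ℝ ∞ fun t => h (Real.exp t) := hh.comp Real.contDiff_exp
  set f : ℝ → ℝ := fun t => h (Real.exp t) with hfdef
  set S := firstOrder (2 * p) (radialIterate (2 * p + 2) f p) with hS
  have hSd : ContDiff ℝ ∞ S := ContDiff.firstOrder (contDiff_radialIterate _ hf p) _
  set φ : ℝ → ℝ := fun r => (-1) ^ (p + 1) * Real.exp (-(2 * ((p + 1 : ℕ) : ℝ)) * Real.log r) *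
    radialIterate (2 * p + 2) f (p + 1) (Real.log r) with hφ
  have hae : ((fun (u : E (2 * p + 2) → ℝ) (y : E (2 * p + 2)) =>
      -Laplacian.laplacian u y)^[p + 1] u) =ᵐ[volume] fun x => φ ‖x‖ := by
    filter_upwards [Measure.ae_ne volume (0 : E (2 * p + 2))] with x hx
    exact iterate_neg_laplacian_eq hf hu (p + 1) x hx
  have hdim : Module.finrank ℝ (E (2 * p + 2)) = 2 * p + 2 := by simp
  -- The polar Jacobian `r^{2p+1}` against `e^{-nt} = r^{-(2p+2)}` leaves `dr / r = dt`.
  have hφ' : ∀ r ∈ Ioi (0 : ℝ), r ^ (Module.finrank ℝ (E (2 * p + 2)) - 1) • φ r =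
      (-1) ^ (p + 1) * (deriv S (Real.log r) * r⁻¹) := by
    intro r hr
    have hr0 : (0 : ℝ) < r := hr
    -- The last factor is `∂ - (2p + 2 - n) = ∂`.
    have hA : radialIterate (2 * p + 2) f (p + 1) (Real.log r) = deriv S (Real.log r) := by
      simp only [radialIterate, ← hS]
      rw [firstOrder]
      push_cast
      ring
    have hexp : Real.exp (-(2 * ((p + 1 : ℕ) : ℝ)) * Real.log r) = (r ^ (2 * p + 2))⁻¹ := by
      rw [neg_mul, Real.exp_neg, show (2 * ((p + 1 : ℕ) : ℝ)) = ((2 * p + 2 : ℕ) : ℝ) by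
        push_cast; ring, Real.exp_nat_mul, Real.exp_log hr0]
    simp only [hφ, hA, hexp, hdim, smul_eq_mul]
    rw [show 2 * p + 2 - 1 = 2 * p + 1 by omega]
    field_simp
    ring
  have hint' : IntegrableOn (fun r => deriv S (Real.log r) * r⁻¹) (Ioi 0) := by
    have h1 := (integrable_fun_norm_addHaar volume).1 ((integrable_congr hae).1 hint)
    have h2 := ((integrableOn_congr_fun hφ' measurableSet_Ioi).1 h1).const_mul ((-1) ^ (p + 1))
    refine h2.congr (Eventually.of_forall fun r => ?_)
    dsimp only
    rw [← mul_assoc, ← pow_add, Even.neg_one_pow ⟨p + 1, rfl⟩, one_mul]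
  refine ⟨_, tendsto_integral_of_log (hSd.differentiable (by simp))
    (tendsto_firstOrder_radialIterate_atBot _ hh p) hint', ?_⟩
  rw [integral_congr_ae hae, integral_fun_norm_addHaar volume φ,
    setIntegral_congr_fun measurableSet_Ioi hφ', integral_const_mul, sphereVolume,
    Measure.toSphere_real_apply_univ, nsmul_eq_mul, smul_eq_mul, ← mul_assoc]

end TotalCurvature

end ConformalRn

/-! ### The Gauss–Bonnet identity -/

theorem mainTheorem8 (n : ℕ) (hn : Even n) (hn0 : 0 < n)
    (w : ConformalRn.E n → ℝ) (hw : ContDiff ℝ ∞ w)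
    (hrad : ∀ x y : ConformalRn.E n, ‖x‖ = ‖y‖ → w x = w y)
    (hA1 : ConformalRn.IsCompleteMetric (ConformalRn.conformalMetric w hw))
    (hA2 : ∃ K : Set (ConformalRn.E n), IsCompact K ∧
      ∀ x ∉ K, 0 ≤ ConformalRn.scalarCurvature (ConformalRn.conformalMetric w hw) x)
    (hA3 : MeasureTheory.Integrable (ConformalRn.qCurvature w)
      (ConformalRn.volumeMeasure (ConformalRn.conformalMetric w hw)))
    (hbdd : ∃ C : ℝ, ∀ x : ConformalRn.E n, ‖x‖ * Real.exp (w x) ≤ C) :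
    ConformalRn.gaussBonnetConstant n *
      ∫ x, ConformalRn.qCurvature w x
        ∂(ConformalRn.volumeMeasure (ConformalRn.conformalMetric w hw)) = 1 := by
  obtain ⟨p, rfl⟩ : ∃ p, n = 2 * p + 2 := by
    obtain ⟨m, hm⟩ := hn
    exact ⟨m - 1, by omega⟩
  have hhalf : (2 * p + 2) / 2 = p + 1 := by omega
  rw [ConformalRn.integrable_qCurvature_iff, hhalf] at hA3
  let e : ConformalRn.E (2 * p + 2) := EuclideanSpace.single 0 1
  have he : ‖e‖ = 1 := by simp [e]
  -- The profile is taken on the whole line through the origin, so it is smooth at `r = 0` too.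
  have hh : ContDiff ℝ ∞ fun r : ℝ => w (r • e) := hw.comp (contDiff_id.smul contDiff_const)
  have hnorm : ∀ t : ℝ, ‖Real.exp t • e‖ = Real.exp t := fun t => by
    rw [norm_smul, he, mul_one, Real.norm_of_nonneg (Real.exp_pos t).le]
  have hu : ∀ x, x ≠ 0 → w x = w (Real.exp (Real.log ‖x‖) • e) := fun x hx =>
    hrad _ _ (by rw [hnorm, Real.exp_log (norm_pos_iff.2 hx)])
  obtain ⟨L, hL, hQ⟩ := ConformalRn.tendsto_total_qCurvature p hh hu hA3
  have hf : ContDiff ℝ ∞ fun t : ℝ => w (Real.exp t • e) := hh.comp Real.contDiff_exp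
  obtain ⟨hlim, hval⟩ := ConformalRn.firstOrder_radialIterate_limits p hf p le_rfl
    ⟨L, (continuous_coe_real_ereal.tendsto L).comp hL⟩
  obtain ⟨C, hC⟩ := hbdd
  have hB : ∀ t : ℝ, w (Real.exp t • e) + t ≤ Real.log C := by
    intro t
    have h := hC (Real.exp t • e)
    rw [hnorm, ← Real.exp_add, add_comm] at h
    exact (Real.le_log_iff_exp_le ((Real.exp_pos _).trans_le h)).2 h
  have hslope := ConformalRn.tendsto_deriv_neg_one (hf.differentiable (by simp)) hlim hB
    fun c ε hε hdec => ConformalRn.not_isCompleteMetric_of_decay w hw he hε hdec hA1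
  have hLval := tendsto_nhds_unique hL (hval _ hslope)
  rw [ConformalRn.integral_qCurvature, hhalf, hQ, hLval, ConformalRn.prod_factors_eq,
    ConformalRn.gaussBonnetConstant, show 2 * p + 2 - 2 = 2 * p by omega]
  have hdf : (Nat.doubleFactorial (2 * p) : ℝ) ≠ 0 := by
    exact_mod_cast (Nat.doubleFactorial_pos _).ne'
  have hsp : ConformalRn.sphereVolume (2 * p + 2) ≠ 0 := by
    rw [ConformalRn.sphereVolume, MeasureTheory.Measure.toSphere_real_apply_univ]
    refine mul_ne_zero (by simp; positivity) ?_
    exact (ENNReal.toReal_pos (Metric.measure_ball_pos _ _ one_pos).ne'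
      MeasureTheory.measure_ball_lt_top.ne).ne'
  -- The signs come from `(-Δ)^{p+1}`, from the product of factors and from the slope `-1`.
  have hsign : ((-1 : ℝ) ^ (p + 1)) * ((-1) ^ p * (-1)) = 1 := by
    rw [← pow_succ, ← pow_add, Even.neg_one_pow ⟨p + 1, rfl⟩]
  field_simp
  linear_combination hsign
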